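/- Consider two users and a transmitter with two antennas. Let $u_1,u_2$ be an orthonormal basis of $\mathbb{C}^2$, let $\lambda_1,\lambda_2,\mu_1,\mu_2>0$, and put $$\Sigma_1=\lambda_1u_1u_1^H+\lambda_2u_2u_2^H,\qquad \Sigma_2=\mu_1u_1u_1^H+\mu_2u_2u_2^H,\qquad \chi_1=\lambda_1/\lambda_2,\quad \chi_2=\mu_1/\mu_2 .$$ (No ordering of the eigenvalues is assumed, so $\chi_1$ and $\chi_2$ may be smaller than $1$.) For $i=1,2$ let the channel of user $i$ be $h_i=\Sigma_i^{1/2}g_i$, where $g_i$ is a random vector in $\mathbb{C}^2$ with i.i.d. $\mathcal{CN}(0,1)$ entries. For unit vectors $w_1,w_2\in\mathbb{C}^2$ and $\rho>0$ let $$\mathcal R_{\rm sum}(w_1,w_2;\rho)=\sum_{i=1}^2E\left[\log\left(1+\frac{\frac{\rho}{2}|h_i^Hw_i|^2}{1+\frac{\rho}{2}|h_i^Hw_j|^2}\right)\right],\qquad j\ne i,$$ be the ergodic sum-rate (natural logarithm). Define $$V=\begin{cases}\dfrac{\chi_1\log\chi_1}{\chi_1-1}+\dfrac{\log\chi_2}{\chi_2-1}&\text{if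 }\chi_1\ge\chi_2,\\[2mm]\dfrac{\chi_2\log\chi_2}{\chi_2-1}+\dfrac{\log\chi_1}{\chi_1-1}&\text{if }\chi_1<\chi_2,\end{cases}$$ where $\frac{\log\chi}{\chi-1}$ and $\frac{\chi\log\chi}{\chi-1}$ are read as $1$ at $\chi=1$. Then all these expectations are finite and, in the high-SNR limit $\rho\to\infty$, the sum-rate is maximized by $(w_1,w_2)=(e^{i\nu_1}u_1,e^{i\nu_2}u_2)$ if $\chi_1\ge\chi_2$, and by $(w_1,w_2)=(e^{i\nu_2}u_2,e^{i\nu_1}u_1)$ if $\chi_1<\chi_2$, for any real $\nu_1,\nu_2$. That is, for all unit vectors $w_1,w_2$ the limit $\lim_{\rho\to\infty}\mathcal R_{\rm sum}(w_1,w_2;\rho)$ exists and is at most $V$, and for the stated choice it equals $V$. Moreover, the optimal ergodic sum-rate $\sup_{\|w_1\|=\|w_2\|=1}\mathcal R_{\rm sum}(w_1,w_2;\rho)$ is finite for every $\rho>0$ and converges to $V$ as $\rho\to\infty$. -/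

import Mathlib

open MeasureTheory ProbabilityTheory Filter Topology
open scoped Matrix MatrixOrder ComplexOrder

noncomputable section

/-- The standard circularly symmetric complex Gaussian law `CN(0,1)`: independent real and
imaginary parts, each centred real Gaussian with variance `1/2`. -/
def stdComplexGaussian : Measure ℂ :=
  ((gaussianReal 0 (1 / 2)).prod (gaussianReal 0 (1 / 2))).map
    (fun p : ℝ × ℝ => (⟨p.1, p.2⟩ : ℂ))

/-- The channel vector `h = Σ^{1/2} g` (with the positive semidefinite square root of `Σ`). -/
def channel {M : ℕ} {Ω : Type*} (S : Matrix (Fin M) (Fin M) ℂ) (g : Fin M → Ω → ℂ) (ω : Ω) :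
    EuclideanSpace ℂ (Fin M) :=
  WithLp.toLp 2 (CFC.sqrt S *ᵥ fun k => g k ω)

/-- The instantaneous rate (in nats) of user `i`, for channel vectors `h`, beamforming
vectors `w` and signal-to-noise ratio `ρ`. Here `inner ℂ (h i) (w j)` is `h_i^H w_j`. -/
def instRate {M : ℕ} (ρ : ℝ) (h w : Fin M → EuclideanSpace ℂ (Fin M)) (i : Fin M) : ℝ :=
  Real.log (1 + (ρ / M * ‖inner ℂ (h i) (w i)‖ ^ 2) /
    (1 + ρ / M * ∑ j ∈ Finset.univ.erase i, ‖inner ℂ (h i) (w j)‖ ^ 2))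

/-- The ergodic sum-rate `∑ i, E[R_i]` of the random channel vectors `h`. -/
def ergodicSumRate {M : ℕ} {Ω : Type*} [MeasurableSpace Ω] (P : Measure Ω)
    (h : Fin M → Ω → EuclideanSpace ℂ (Fin M)) (w : Fin M → EuclideanSpace ℂ (Fin M))
    (ρ : ℝ) : ℝ :=
  ∑ i, ∫ ω, instRate ρ (fun k => h k ω) w i ∂P

/-- The ergodic sum-rates that unit-norm beamforming vectors achieve at `ρ`. -/
def achievableSumRates {M : ℕ} {Ω : Type*} [MeasurableSpace Ω] (P : Measure Ω)
    (h : Fin M → Ω → EuclideanSpace ℂ (Fin M)) (ρ : ℝ) : Set ℝ :=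
  {r | ∃ w : Fin M → EuclideanSpace ℂ (Fin M), (∀ i, ‖w i‖ = 1) ∧ r = ergodicSumRate P h w ρ}

/-- The matrix `[u₁, …, u_M] diag(ev) [u₁, …, u_M]^H`. -/
def spectralMatrix {M : ℕ} (u : Fin M → EuclideanSpace ℂ (Fin M)) (ev : Fin M → ℝ) :
    Matrix (Fin M) (Fin M) ℂ :=
  (Matrix.of fun a k => u k a) * Matrix.diagonal (fun k => (ev k : ℂ)) *
    (Matrix.of fun a k => u k a)ᴴ

/-- `log x / (x - 1)`, continuously extended by `1` at `x = 1`. -/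
def logRatio (x : ℝ) : ℝ := if x = 1 then 1 else Real.log x / (x - 1)

/-- The limiting optimal sum-rate, as a function of the two condition numbers. -/
def limitValue (χ₁ χ₂ : ℝ) : ℝ :=
  if χ₂ ≤ χ₁ then χ₁ * logRatio χ₁ + logRatio χ₂ else χ₂ * logRatio χ₂ + logRatio χ₁

/-- The two-user beamforming vectors `(e^{iν₁} u₁, e^{iν₂} u₂)` if `χ₁ ≥ χ₂`, and
`(e^{iν₂} u₂, e^{iν₁} u₁)` otherwise. -/
def optimalBeams (u : Fin 2 → EuclideanSpace ℂ (Fin 2)) (χ₁ χ₂ : ℝ) (ν : Fin 2 → ℝ) :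
    Fin 2 → EuclideanSpace ℂ (Fin 2) :=
  if χ₂ ≤ χ₁ then
    ![Complex.exp (ν 0 * Complex.I) • u 0, Complex.exp (ν 1 * Complex.I) • u 1]
  else
    ![Complex.exp (ν 1 * Complex.I) • u 1, Complex.exp (ν 0 * Complex.I) • u 0]

end

/-! The argument reduces the ergodic rates to deterministic integrals, and the optimization over the
beams to an elementary inequality between two-by-two determinants and traces.

Fix a user with covariance `Σ`, own beam `a` and interfering beam `b`, and write `X = |h^H a|²`,
`Y = |h^H b|²`. By completing squares in Gaussian integrals, `X + Y` has Laplace transform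
`(1 + S s + D s²)⁻¹` with `S = a^H Σ a + b^H Σ b` and `D = det Σ · |det (a, b)|²`, and `Y` has Laplace
transform `(1 + T s)⁻¹` with `T = b^H Σ b`. Writing `log (1 + r X / (1 + r Y))` as the Frullani integral
of `(exp (-s (r⁻¹ + Y)) - exp (-s (r⁻¹ + X + Y))) / s` and exchanging the integrals, the ergodic rate
at `r = ρ / 2` becomes the integral over `s > 0` of `exp (-s / r)` times the nonnegative kernel
`k(s) = ((1 + T s)⁻¹ - (1 + S s + D s²)⁻¹) / s` (`integral_log_one_add_div`, `integral_log_channel`).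
So the rate at every SNR is at most `∫ k`, and converges to it by dominated convergence.

The kernel is increasing in `S` and in `D`. When `1 + S s + D s²` factors as `(1 + x s) (1 + y s)`
the integral is elementary (`integral_rateKernel`), and scaling `x`, `y` by `c` adds `log c` to it. Hence
`∫ k` is at most `log c - log T` plus a function of the eigenvalues of `Σ`, where `c` is the larger of
`S / tr Σ` and the square root of `|det (a, b)|²` (`powerScale`). For the eigenbeams `c = 1` and
equality holds.

It remains to see that the two factors `c₁`, `c₂` satisfy `c₁ c₂ χ₂ ≤ t₁ t₂` if `χ₂ ≤ χ₁`, where `t₁`, `t₂`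
are the interference powers in units of the second eigenvalues (`powerScale_mul_powerScale_le`).
With `p`, `q` the squared components of the two beams along the first eigenvector, `S / tr Σ` is
monotone in the condition number, increasing for `p + q ≥ 1` and decreasing for `p + q ≤ 1`. This
allows one to replace the smaller condition number by the larger one or conversely. For equal
condition numbers the claim is the Cauchy–Schwarz inequality `D ≤ (a^H Σ a) (b^H Σ b)` together
with a bound on the ratio of the arithmetic and geometric means of two numbers whose quotient lies
between `χ⁻¹` and `χ` (`powerScale_sq_mul_le`). -/

/-! ### Gaussian integrals -/

theorem integral_exp_quadratic_gaussianReal {α : ℝ} (hα : -1 < α) (c : ℝ) :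
    ∫ x, Real.exp (-α * x ^ 2 + c * x) ∂(gaussianReal 0 (1 / 2)) =
      (√(1 + α))⁻¹ * Real.exp (c ^ 2 / (4 * (1 + α))) := by
  have h1 : 0 < 1 + α := by linarith
  rw [integral_gaussianReal_eq_integral_smul (by norm_num)]
  have hint : ∀ x : ℝ, gaussianPDFReal 0 (1 / 2) x • Real.exp (-α * x ^ 2 + c * x) =
      ((√Real.pi)⁻¹ * Real.exp (c ^ 2 / (4 * (1 + α)))) *
        Real.exp (-(1 + α) * (x - c / (2 * (1 + α))) ^ 2) := by
    intro x
    rw [gaussianPDFReal, smul_eq_mul, mul_assoc (√_)⁻¹, mul_assoc (√_)⁻¹, ← Real.exp_add,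
      ← Real.exp_add]
    congr 1
    · rw [mul_right_comm]
      simp
    · congr 1
      push_cast
      field_simp
      ring
  simp_rw [hint]
  rw [integral_const_mul,
    integral_sub_right_eq_self (fun x : ℝ => Real.exp (-(1 + α) * x ^ 2)), integral_gaussian,
    Real.sqrt_div' _ h1.le]
  have : √Real.pi ≠ 0 := (Real.sqrt_pos.2 Real.pi_pos).ne'
  field_simp

instance isProbabilityMeasure_stdComplexGaussian : IsProbabilityMeasure stdComplexGaussian := by
  have h : Measurable (fun p : ℝ × ℝ => (⟨p.1, p.2⟩ : ℂ)) :=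
    Complex.measurableEquivRealProd.symm.measurable
  exact Measure.isProbabilityMeasure_map h.aemeasurable

theorem integral_exp_quadratic_stdComplexGaussian {α : ℝ} (hα : -1 < α) (k : ℂ) :
    ∫ z, Real.exp (-α * ‖z‖ ^ 2 + 2 * (z * k).re) ∂stdComplexGaussian =
      (1 + α)⁻¹ * Real.exp (‖k‖ ^ 2 / (1 + α)) := by
  have h : Measurable (fun p : ℝ × ℝ => (⟨p.1, p.2⟩ : ℂ)) :=
    Complex.measurableEquivRealProd.symm.measurable
  have h1 : 0 < 1 + α := by linarith
  rw [stdComplexGaussian, integral_map h.aemeasurable (by fun_prop)]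
  have hsplit : ∀ p : ℝ × ℝ, Real.exp (-α * ‖(⟨p.1, p.2⟩ : ℂ)‖ ^ 2 +
      2 * ((⟨p.1, p.2⟩ : ℂ) * k).re) =
      Real.exp (-α * p.1 ^ 2 + (2 * k.re) * p.1) * Real.exp (-α * p.2 ^ 2 + (-2 * k.im) * p.2) := by
    intro p
    rw [← Real.exp_add, Complex.sq_norm, Complex.normSq_mk, Complex.mul_re]
    congr 1
    ring
  simp_rw [hsplit]
  rw [integral_prod_mul (fun x : ℝ => Real.exp (-α * x ^ 2 + (2 * k.re) * x))
    (fun y : ℝ => Real.exp (-α * y ^ 2 + (-2 * k.im) * y)),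
    integral_exp_quadratic_gaussianReal hα, integral_exp_quadratic_gaussianReal hα,
    mul_mul_mul_comm, ← mul_inv, Real.mul_self_sqrt h1.le, ← Real.exp_add, Complex.sq_norm,
    Complex.normSq_apply]
  congr 2
  field_simp
  ring

/-- Lagrange's identity. -/
theorem norm_sq_mul_sub_norm_sq_eq (a₀ a₁ b₀ b₁ : ℂ) :
    (‖a₀‖ ^ 2 + ‖a₁‖ ^ 2) * (‖b₀‖ ^ 2 + ‖b₁‖ ^ 2) - ‖star a₀ * b₀ + star a₁ * b₁‖ ^ 2 =
      ‖a₀ * b₁ - a₁ * b₀‖ ^ 2 := by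
  simp only [Complex.sq_norm, Complex.normSq_apply, Complex.add_re, Complex.add_im,
    Complex.mul_re, Complex.mul_im, Complex.star_def, Complex.conj_re, Complex.conj_im,
    Complex.sub_re, Complex.sub_im]
  ring

/-- The Laplace transform at `1` of the nonnegative Hermitian form `z ↦ ∑ⱼ |∑ₖ z̄ₖ vⱼₖ|²` of rank at
most two. The Gaussian integral over `z₀` is computed first, by completing the square; the one
over `z₁` is then a Gaussian integral again. -/
theorem integral_exp_neg_stdComplexGaussian_prod (a b : Fin 2 → ℂ) :
    ∫ z : ℂ × ℂ, Real.exp (-(‖star z.1 * a 0 + star z.2 * a 1‖ ^ 2 +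
        ‖star z.1 * b 0 + star z.2 * b 1‖ ^ 2)) ∂(stdComplexGaussian.prod stdComplexGaussian) =
      (1 + (‖a 0‖ ^ 2 + ‖a 1‖ ^ 2 + ‖b 0‖ ^ 2 + ‖b 1‖ ^ 2) + ‖a 0 * b 1 - a 1 * b 0‖ ^ 2)⁻¹ := by
  rw [integral_prod_symm]
  swap
  · refine Integrable.of_bound (by fun_prop) 1 (Eventually.of_forall fun z => ?_)
    rw [Real.norm_eq_abs, Real.abs_exp, Real.exp_le_one_iff]
    have := sq_nonneg ‖star z.1 * a 0 + star z.2 * a 1‖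
    have := sq_nonneg ‖star z.1 * b 0 + star z.2 * b 1‖
    linarith
  set α := ‖a 0‖ ^ 2 + ‖b 0‖ ^ 2 with hα
  set β := ‖a 1‖ ^ 2 + ‖b 1‖ ^ 2 with hβ
  set κ := star (a 0) * a 1 + star (b 0) * b 1 with hκ
  have hα0 : 0 ≤ α := by positivity
  have hβ0 : 0 ≤ β := by positivity
  have hdet : α * β - ‖κ‖ ^ 2 = ‖a 0 * b 1 - a 1 * b 0‖ ^ 2 := by
    rw [norm_sq_mul_sub_norm_sq_eq, mul_comm (b 0)]
  have hform : ∀ x y : ℂ, -(‖star x * a 0 + star y * a 1‖ ^ 2 + ‖star x * b 0 + star y * b 1‖ ^ 2) =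
      (-α * ‖x‖ ^ 2 + 2 * (x * (-(star y * κ))).re) + -β * ‖y‖ ^ 2 := by
    intro x y
    simp only [hα, hβ, hκ, Complex.sq_norm, Complex.normSq_apply, Complex.add_re, Complex.add_im,
      Complex.mul_re, Complex.mul_im, Complex.star_def, Complex.conj_re, Complex.conj_im,
      Complex.neg_re, Complex.neg_im]
    ring
  have hinner : ∀ y : ℂ, ∫ x, Real.exp (-(‖star x * a 0 + star y * a 1‖ ^ 2 +
      ‖star x * b 0 + star y * b 1‖ ^ 2)) ∂stdComplexGaussian =
      (1 + α)⁻¹ * Real.exp (-(β - ‖κ‖ ^ 2 / (1 + α)) * ‖y‖ ^ 2 + 2 * (y * 0).re) := by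
    intro y
    simp_rw [hform, Real.exp_add _ (-β * ‖y‖ ^ 2)]
    rw [integral_mul_const, integral_exp_quadratic_stdComplexGaussian (by linarith), mul_assoc,
      ← Real.exp_add]
    congr 2
    rw [norm_neg, norm_mul, norm_star]
    simp only [mul_zero, Complex.zero_re]
    ring
  simp only [hinner]
  have hdet0 := sq_nonneg ‖a 0 * b 1 - a 1 * b 0‖
  have h1 : 0 < 1 + α := by linarith
  have hlt : -1 < β - ‖κ‖ ^ 2 / (1 + α) := by
    rw [lt_sub_iff_add_lt, ← lt_sub_iff_add_lt', div_lt_iff₀ h1]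
    nlinarith
  rw [integral_const_mul, integral_exp_quadratic_stdComplexGaussian hlt, norm_zero, ← hdet]
  have hne : 1 + (β - ‖κ‖ ^ 2 / (1 + α)) ≠ 0 := by linarith
  rw [show (0:ℝ) ^ 2 / (1 + (β - ‖κ‖ ^ 2 / (1 + α))) = 0 by simp, Real.exp_zero, mul_one, ← mul_inv]
  congr 1
  field_simp
  rw [hα, hβ]
  ring

/-! ### A Frullani integral -/

theorem lintegral_Ioi_exp_neg_mul {y : ℝ} (hy : 0 < y) :
    ∫⁻ t in Set.Ioi (0 : ℝ), ENNReal.ofReal (Real.exp (-(t * y))) = ENNReal.ofReal y⁻¹ := by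
  have hi := integrableOn_exp_mul_Ioi (neg_lt_zero.2 hy) 0
  have h := integral_exp_mul_Ioi (neg_lt_zero.2 hy) 0
  simp_rw [show ∀ t : ℝ, -y * t = -(t * y) from fun t => by ring] at hi h
  rw [← ofReal_integral_eq_lintegral_ofReal hi (Eventually.of_forall fun t => (Real.exp_pos _).le),
    h]
  congr 1
  simp

theorem lintegral_frullani_exp {a b : ℝ} (hb : 0 < b) (hab : b ≤ a) :
    ∫⁻ t in Set.Ioi (0 : ℝ), ENNReal.ofReal ((Real.exp (-(t * b)) - Real.exp (-(t * a))) / t) =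
      ENNReal.ofReal (Real.log a - Real.log b) := by
  have hin : ∀ t ∈ Set.Ioi (0 : ℝ),
      ENNReal.ofReal ((Real.exp (-(t * b)) - Real.exp (-(t * a))) / t) =
        ∫⁻ y in Set.Ioc b a, ENNReal.ofReal (Real.exp (-(t * y))) := by
    intro t ht
    have ht' : t ≠ 0 := (Set.mem_Ioi.1 ht).ne'
    have hder : ∀ y ∈ Set.uIcc b a, HasDerivAt (fun y => -Real.exp (-(t * y)) / t)
        (Real.exp (-(t * y))) y := by
      intro y _
      refine (((hasDerivAt_const_mul t (x := y)).fun_neg.exp.fun_neg).div_const t).congr_deriv ?_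
      field_simp
    have hc : Continuous fun y : ℝ => Real.exp (-(t * y)) := by fun_prop
    rw [← ofReal_integral_eq_lintegral_ofReal (hc.integrableOn_Ioc)
      (Eventually.of_forall fun y => (Real.exp_pos _).le),
      ← intervalIntegral.integral_of_le hab,
      intervalIntegral.integral_eq_sub_of_hasDerivAt hder (hc.intervalIntegrable _ _)]
    congr 1
    ring
  rw [setLIntegral_congr_fun measurableSet_Ioi hin, lintegral_lintegral_swap (by fun_prop)]
  have hin2 : ∀ y ∈ Set.Ioc b a,
      ∫⁻ t in Set.Ioi (0 : ℝ), ENNReal.ofReal (Real.exp (-(t * y))) = ENNReal.ofReal y⁻¹ :=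
    fun y hy => lintegral_Ioi_exp_neg_mul (hb.trans hy.1)
  rw [setLIntegral_congr_fun measurableSet_Ioc hin2]
  have h0 : (0 : ℝ) ∉ Set.uIcc b a := by
    rw [Set.uIcc_of_le hab]
    exact fun h => absurd h.1 (not_le.2 hb)
  have hii : IntervalIntegrable (fun y : ℝ => y⁻¹) volume b a :=
    intervalIntegral.intervalIntegrable_inv (fun x hx h => h0 (h ▸ hx)) continuousOn_id
  rw [← ofReal_integral_eq_lintegral_ofReal
      ((intervalIntegrable_iff_integrableOn_Ioc_of_le hab).1 hii)
    ((ae_restrict_iff' measurableSet_Ioc).2 (Eventually.of_forall fun y hy =>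
      inv_nonneg.2 (hb.trans hy.1).le)),
    ← intervalIntegral.integral_of_le hab, integral_inv h0, Real.log_div (hb.trans_le hab).ne' hb.ne']

/-! ### The integral representation of an ergodic rate -/

/-- With `T`, `S`, `D` such that the interference power `Y` has Laplace transform `(1 + T s)⁻¹` and the
total received power `X + Y` has Laplace transform `(1 + S s + D s ^ 2)⁻¹`, the density on `(0, ∞)`
whose integral is the high-SNR limit of the ergodic rate. -/
noncomputable def rateKernel (T S D s : ℝ) : ℝ := ((1 + T * s)⁻¹ - (1 + S * s + D * s ^ 2)⁻¹) / s

theorem rateKernel_nonneg {T S D s : ℝ} (hT : 0 ≤ T) (hTS : T ≤ S) (hD : 0 ≤ D) (hs : 0 < s) :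
    0 ≤ rateKernel T S D s := by
  refine div_nonneg (sub_nonneg.2 (inv_anti₀ (by positivity) ?_)) hs.le
  have := mul_le_mul_of_nonneg_right hTS hs.le
  have : 0 ≤ D * s ^ 2 := by positivity
  linarith

theorem rateKernel_mono {T S D S' D' s : ℝ} (hS0 : 0 ≤ S) (hD0 : 0 ≤ D) (hS : S ≤ S') (hD : D ≤ D')
    (hs : 0 < s) : rateKernel T S D s ≤ rateKernel T S' D' s := by
  unfold rateKernel
  gcongr

theorem measurable_rateKernel (T S D : ℝ) : Measurable (rateKernel T S D) := by
  unfold rateKernel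
  fun_prop

theorem integrableOn_and_integral_rateKernel_of_hasDerivAt {T a b : ℝ} (hT : 0 < T)
    (ha : 0 < a) (hb : 0 < b) (hTS : T ≤ a + b) {g : ℝ → ℝ} {l : ℝ} (hc : ContinuousWithinAt g (Set.Ici 0) 0)
    (hg : ∀ s ∈ Set.Ioi (0 : ℝ), HasDerivAt g (rateKernel T (a + b) (a * b) s) s)
    (hl : Tendsto g atTop (𝓝 l)) :
    IntegrableOn (rateKernel T (a + b) (a * b)) (Set.Ioi 0) ∧
      ∫ s in Set.Ioi 0, rateKernel T (a + b) (a * b) s = l - g 0 :=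
  have h0 : ∀ s ∈ Set.Ioi (0 : ℝ), 0 ≤ rateKernel T (a + b) (a * b) s := fun _ hs =>
    rateKernel_nonneg hT.le hTS (mul_pos ha hb).le hs
  ⟨integrableOn_Ioi_deriv_of_nonneg hc hg h0 hl, integral_Ioi_of_hasDerivAt_of_nonneg hc hg h0 hl⟩

theorem tendsto_log_inv_add_atTop {c : ℝ} (hc : 0 < c) :
    Tendsto (fun s : ℝ => Real.log (s⁻¹ + c)) atTop (𝓝 (Real.log c)) := by
  have h : Tendsto (fun s : ℝ => s⁻¹ + c) atTop (𝓝 (0 + c)) := tendsto_inv_atTop_zero.add_const c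
  rw [zero_add] at h
  exact (Real.continuousAt_log hc.ne').tendsto.comp h

theorem log_one_add_mul_eq {c s : ℝ} (hc : 0 < c) (hs : 0 < s) :
    Real.log (1 + c * s) = Real.log s + Real.log (s⁻¹ + c) := by
  rw [← Real.log_mul hs.ne' (by positivity)]
  congr 1
  field_simp

theorem hasDerivAt_log_one_add_mul {c s : ℝ} (hc : 0 < c) (hs : 0 ≤ s) :
    HasDerivAt (fun s : ℝ => Real.log (1 + c * s)) (c / (1 + c * s)) s :=
  ((hasDerivAt_const_mul c (x := s)).const_add 1).log (by positivity)

/-- The integral of the kernel when the quadratic is `(1 + a s) (1 + b s)`, by partial fractions. -/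
theorem integral_rateKernel {T a b : ℝ} (hT : 0 < T) (ha : 0 < a) (hb : 0 < b)
    (hTS : T ≤ a + b) :
    IntegrableOn (rateKernel T (a + b) (a * b)) (Set.Ioi 0) ∧
      ∫ s in Set.Ioi 0, rateKernel T (a + b) (a * b) s =
        Real.log b + a / b * logRatio (a / b) - Real.log T := by
  rcases eq_or_ne a b with rfl | hab
  · have hd : ∀ s : ℝ, 0 ≤ s → HasDerivAt
        (fun s : ℝ => Real.log (1 + a * s) - Real.log (1 + T * s) - (1 + a * s)⁻¹)
        (a / (1 + a * s) - T / (1 + T * s) - -a / (1 + a * s) ^ 2) s := fun s hs =>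
      ((hasDerivAt_log_one_add_mul ha hs).fun_sub (hasDerivAt_log_one_add_mul hT hs)).fun_sub
        (((hasDerivAt_const_mul a (x := s)).const_add 1).fun_inv (by positivity))
    -- the terms `log s` of the antiderivative cancel at infinity
    have hl : Tendsto (fun s : ℝ => Real.log (1 + a * s) - Real.log (1 + T * s) - (1 + a * s)⁻¹)
        atTop (𝓝 (Real.log a - Real.log T - 0)) := by
      refine Tendsto.sub (((tendsto_log_inv_add_atTop ha).sub
        (tendsto_log_inv_add_atTop hT)).congr' ?_) ?_
      · filter_upwards [eventually_gt_atTop 0] with s hs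
        rw [log_one_add_mul_eq ha hs, log_one_add_mul_eq hT hs]
        ring
      · exact tendsto_inv_atTop_zero.comp
          (tendsto_atTop_add_const_left _ _ (tendsto_id.const_mul_atTop ha))
    have h := integrableOn_and_integral_rateKernel_of_hasDerivAt hT ha hb hTS
      (hd 0 le_rfl).continuousAt.continuousWithinAt
      (fun s hs => (hd s (le_of_lt hs)).congr_deriv ?_) hl
    · refine ⟨h.1, h.2.trans ?_⟩
      rw [div_self ha.ne', logRatio, if_pos rfl]
      simp
      ring
    · have hs' : 0 < s := hs
      have e : 1 + (a + a) * s + a * a * s ^ 2 = (1 + a * s) ^ 2 := by ring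
      have h1 : 1 + a * s ≠ 0 := by positivity
      have h2 : 1 + T * s ≠ 0 := by positivity
      rw [rateKernel, e]
      field_simp
      ring
  · have hab' : a - b ≠ 0 := sub_ne_zero.2 hab
    have hd : ∀ s : ℝ, 0 ≤ s → HasDerivAt
        (fun s : ℝ => (a * Real.log (1 + a * s) - b * Real.log (1 + b * s)) / (a - b) -
          Real.log (1 + T * s))
        ((a * (a / (1 + a * s)) - b * (b / (1 + b * s))) / (a - b) - T / (1 + T * s)) s :=
      fun s hs => ((((hasDerivAt_log_one_add_mul ha hs).const_mul a).fun_sub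
        ((hasDerivAt_log_one_add_mul hb hs).const_mul b)).div_const _).fun_sub
          (hasDerivAt_log_one_add_mul hT hs)
    -- the terms `log s` of the antiderivative cancel at infinity
    have hl : Tendsto (fun s : ℝ => (a * Real.log (1 + a * s) - b * Real.log (1 + b * s)) / (a - b) -
          Real.log (1 + T * s)) atTop
        (𝓝 ((a * Real.log a - b * Real.log b) / (a - b) - Real.log T)) := by
      refine (((((tendsto_log_inv_add_atTop ha).const_mul a).sub
        ((tendsto_log_inv_add_atTop hb).const_mul b)).div_const (a - b)).sub
        (tendsto_log_inv_add_atTop hT)).congr' ?_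
      filter_upwards [eventually_gt_atTop 0] with s hs
      rw [log_one_add_mul_eq ha hs, log_one_add_mul_eq hb hs, log_one_add_mul_eq hT hs]
      field_simp
      ring
    have h := integrableOn_and_integral_rateKernel_of_hasDerivAt hT ha hb hTS
      (hd 0 le_rfl).continuousAt.continuousWithinAt
      (fun s hs => (hd s (le_of_lt hs)).congr_deriv ?_) hl
    · refine ⟨h.1, h.2.trans ?_⟩
      have hne : a / b ≠ 1 := fun h => hab ((div_eq_one_iff_eq hb.ne').1 h)
      rw [logRatio, if_neg hne, Real.log_div ha.ne' hb.ne']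
      have : a / b - 1 = (a - b) / b := by field_simp
      rw [this]
      simp
      field_simp
      ring
    · have hs' : 0 < s := hs
      have e : 1 + (a + b) * s + a * b * s ^ 2 = (1 + a * s) * (1 + b * s) := by ring
      have h1 : 1 + a * s ≠ 0 := by positivity
      have h2 : 1 + T * s ≠ 0 := by positivity
      have h3 : 1 + b * s ≠ 0 := by positivity
      rw [rateKernel, e]
      field_simp
      ring

/-- If `S` and `D` are at most the trace and the determinant of `c` times a matrix with eigenvalues
`a`, `b`, then the limiting rate is at most that of `a`, `b` plus `log c`, by monotonicity and
scaling of the kernel. -/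
theorem integral_rateKernel_le {T S D a b c : ℝ} (hT : 0 < T) (ha : 0 < a) (hb : 0 < b) (hc : 0 < c)
    (hTS : T ≤ S) (hD : 0 ≤ D) (hSc : S ≤ c * (a + b)) (hDc : D ≤ c ^ 2 * (a * b)) :
    IntegrableOn (rateKernel T S D) (Set.Ioi 0) ∧
      ∫ s in Set.Ioi 0, rateKernel T S D s ≤
        Real.log c + Real.log b + a / b * logRatio (a / b) - Real.log T := by
  have h := integral_rateKernel hT (mul_pos hc ha) (mul_pos hc hb) (by linarith)
  have hle : ∀ s ∈ Set.Ioi (0 : ℝ),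
      rateKernel T S D s ≤ rateKernel T (c * a + c * b) (c * a * (c * b)) s := fun s hs =>
    rateKernel_mono (hT.le.trans hTS) hD (by linarith) (by linarith) hs
  have hi : IntegrableOn (rateKernel T S D) (Set.Ioi 0) := by
    refine h.1.mono' (measurable_rateKernel T S D).aestronglyMeasurable
      ((ae_restrict_iff' measurableSet_Ioi).2 (Eventually.of_forall fun s hs => ?_))
    rw [Real.norm_of_nonneg (rateKernel_nonneg hT.le hTS hD hs)]
    exact hle s hs
  refine ⟨hi, (setIntegral_mono_on hi h.1 measurableSet_Ioi hle).trans_eq ?_⟩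
  rw [h.2, mul_div_mul_left _ _ hc.ne', Real.log_mul hc.ne' hb.ne']

theorem integrable_exp_neg_mul {Ω : Type*} [MeasurableSpace Ω] {P : Measure Ω}
    [IsProbabilityMeasure P] {X : Ω → ℝ} (hX : AEMeasurable X P) (hX0 : ∀ ω, 0 ≤ X ω) {t : ℝ}
    (ht : 0 ≤ t) : Integrable (fun ω => Real.exp (-(t * X ω))) P := by
  refine Integrable.of_bound (by fun_prop) 1 (Eventually.of_forall fun ω => ?_)
  rw [Real.norm_eq_abs, Real.abs_exp, Real.exp_le_one_iff]
  have := mul_nonneg ht (hX0 ω)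
  linarith

/-- The expected rate at finite SNR: expand the logarithm by a Frullani integral, exchange the
integrals, and insert the Laplace transforms. -/
theorem integral_log_one_add_div {Ω : Type*} [MeasurableSpace Ω] {P : Measure Ω}
    [IsProbabilityMeasure P] {X Y : Ω → ℝ} (hX : AEMeasurable X P) (hY : AEMeasurable Y P)
    (hX0 : ∀ ω, 0 ≤ X ω) (hY0 : ∀ ω, 0 ≤ Y ω) {T S D : ℝ} (hT : 0 ≤ T) (hTS : T ≤ S) (hD : 0 ≤ D)
    (hLY : ∀ t : ℝ, 0 < t → ∫ ω, Real.exp (-(t * Y ω)) ∂P = (1 + T * t)⁻¹)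
    (hLXY : ∀ t : ℝ, 0 < t → ∫ ω, Real.exp (-(t * (X ω + Y ω))) ∂P = (1 + S * t + D * t ^ 2)⁻¹)
    (hi : IntegrableOn (rateKernel T S D) (Set.Ioi 0)) {r : ℝ} (hr : 0 < r) :
    Integrable (fun ω => Real.log (1 + r * X ω / (1 + r * Y ω))) P ∧
      ∫ ω, Real.log (1 + r * X ω / (1 + r * Y ω)) ∂P =
        ∫ s in Set.Ioi 0, Real.exp (-(s / r)) * rateKernel T S D s := by
  have hr' : 0 < r⁻¹ := inv_pos.2 hr
  have hpos : ∀ ω, 0 ≤ Real.log (1 + r * X ω / (1 + r * Y ω)) := fun ω =>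
    Real.log_nonneg (le_add_of_nonneg_right (div_nonneg (mul_nonneg hr.le (hX0 ω))
      (add_nonneg zero_le_one (mul_nonneg hr.le (hY0 ω)))))
  have hlog : ∀ ω, Real.log (1 + r * X ω / (1 + r * Y ω)) =
      Real.log (r⁻¹ + (X ω + Y ω)) - Real.log (r⁻¹ + Y ω) := by
    intro ω
    have hx := hX0 ω
    have hy := hY0 ω
    rw [← Real.log_div (by positivity) (by positivity)]
    congr 1
    have : 1 + r * Y ω ≠ 0 := by positivity
    have : r⁻¹ + Y ω ≠ 0 := by positivity
    field_simp
    ring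
  have hker : ∀ s ∈ Set.Ioi (0 : ℝ),
      0 ≤ Real.exp (-(s / r)) * rateKernel T S D s := fun s hs =>
    mul_nonneg (Real.exp_pos _).le (rateKernel_nonneg hT hTS hD hs)
  have hmeas : AEMeasurable (fun ω => Real.log (1 + r * X ω / (1 + r * Y ω))) P := by fun_prop
  have hi' : IntegrableOn (fun s => Real.exp (-(s / r)) * rateKernel T S D s) (Set.Ioi 0) := by
    refine Integrable.mono' hi ((by fun_prop : Measurable fun s : ℝ => Real.exp (-(s / r))).mul
      (measurable_rateKernel T S D)).aestronglyMeasurable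
      ((ae_restrict_iff' measurableSet_Ioi).2 (Eventually.of_forall fun s hs => ?_))
    rw [Real.norm_of_nonneg (hker s hs)]
    refine mul_le_of_le_one_left (rateKernel_nonneg hT hTS hD hs) (Real.exp_le_one_iff.2 ?_)
    exact neg_nonpos.2 (div_nonneg (le_of_lt hs) hr.le)
  have hlin : ∫⁻ ω, ENNReal.ofReal (Real.log (1 + r * X ω / (1 + r * Y ω))) ∂P =
      ∫⁻ s in Set.Ioi 0, ENNReal.ofReal (Real.exp (-(s / r)) * rateKernel T S D s) := by
    have h1 : ∀ ω, ENNReal.ofReal (Real.log (1 + r * X ω / (1 + r * Y ω))) =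
        ∫⁻ s in Set.Ioi (0 : ℝ), ENNReal.ofReal ((Real.exp (-(s * (r⁻¹ + Y ω))) -
          Real.exp (-(s * (r⁻¹ + (X ω + Y ω))))) / s) := by
      intro ω
      rw [hlog, lintegral_frullani_exp (add_pos_of_pos_of_nonneg hr' (hY0 ω))
        (by linarith [hX0 ω])]
    simp_rw [h1]
    have hX' : AEMeasurable (fun z : Ω × ℝ => X z.1) (P.prod (volume.restrict (Set.Ioi 0))) :=
      hX.comp_fst
    have hY' : AEMeasurable (fun z : Ω × ℝ => Y z.1) (P.prod (volume.restrict (Set.Ioi 0))) :=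
      hY.comp_fst
    rw [lintegral_lintegral_swap (by simp only [Function.uncurry_def]; fun_prop)]
    refine setLIntegral_congr_fun measurableSet_Ioi fun s hs => ?_
    have hs' : 0 < s := hs
    have hX1 := integrable_exp_neg_mul (X := fun ω => X ω + Y ω) (hX.add hY)
      (fun ω => add_nonneg (hX0 ω) (hY0 ω)) hs'.le
    have hY1 := integrable_exp_neg_mul hY hY0 hs'.le
    have h2 : ∀ ω, (Real.exp (-(s * (r⁻¹ + Y ω))) - Real.exp (-(s * (r⁻¹ + (X ω + Y ω))))) / s =
        Real.exp (-(s / r)) / s *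
          (Real.exp (-(s * Y ω)) - Real.exp (-(s * (X ω + Y ω)))) := by
      intro ω
      rw [show -(s * (r⁻¹ + Y ω)) = -(s / r) + -(s * Y ω) by ring,
        show -(s * (r⁻¹ + (X ω + Y ω))) = -(s / r) + -(s * (X ω + Y ω)) by ring, Real.exp_add,
        Real.exp_add]
      ring
    simp_rw [h2]
    rw [← ofReal_integral_eq_lintegral_ofReal ((hY1.sub' hX1).const_mul _)
      (Eventually.of_forall fun ω => ?_)]
    · congr 1
      rw [integral_const_mul, integral_sub hY1 hX1, hLY s hs', hLXY s hs', rateKernel]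
      ring
    · refine mul_nonneg (by positivity) (sub_nonneg.2 (Real.exp_le_exp.2 ?_))
      nlinarith [hX0 ω]
  refine ⟨⟨hmeas.aestronglyMeasurable, ?_⟩, ?_⟩
  · rw [hasFiniteIntegral_iff_ofReal (Eventually.of_forall hpos), hlin,
      ← hasFiniteIntegral_iff_ofReal ((ae_restrict_iff' measurableSet_Ioi).2
        (Eventually.of_forall hker))]
    exact hi'.2
  · rw [integral_eq_lintegral_of_nonneg_ae (Eventually.of_forall hpos) hmeas.aestronglyMeasurable,
      hlin, integral_eq_lintegral_of_nonneg_ae ((ae_restrict_iff' measurableSet_Ioi).2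
        (Eventually.of_forall hker)) hi'.1]

theorem tendsto_integral_exp_mul_rateKernel {T S D : ℝ} (hT : 0 ≤ T) (hTS : T ≤ S) (hD : 0 ≤ D)
    (hi : IntegrableOn (rateKernel T S D) (Set.Ioi 0)) :
    Tendsto (fun r : ℝ => ∫ s in Set.Ioi 0, Real.exp (-(s / r)) * rateKernel T S D s) atTop
      (𝓝 (∫ s in Set.Ioi 0, rateKernel T S D s)) := by
  refine tendsto_integral_filter_of_dominated_convergence (rateKernel T S D)
    (Eventually.of_forall fun r => ((by fun_prop : Measurable fun s : ℝ =>
      Real.exp (-(s / r))).mul (measurable_rateKernel T S D)).aestronglyMeasurable) ?_ hi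
    (Eventually.of_forall fun s => ?_)
  · filter_upwards [eventually_gt_atTop 0] with r hr
    refine (ae_restrict_iff' measurableSet_Ioi).2 (Eventually.of_forall fun s hs => ?_)
    have hk := rateKernel_nonneg hT hTS hD hs
    rw [Real.norm_of_nonneg (mul_nonneg (Real.exp_pos _).le hk)]
    refine mul_le_of_le_one_left hk (Real.exp_le_one_iff.2 ?_)
    exact neg_nonpos.2 (div_nonneg (le_of_lt hs) hr.le)
  · have h : Tendsto (fun r : ℝ => Real.exp (-(s / r))) atTop (𝓝 1) := by
      have h0 : Tendsto (fun r : ℝ => -(s / r)) atTop (𝓝 (-0)) :=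
        (tendsto_const_nhds.div_atTop tendsto_id).neg
      have := (Real.continuous_exp.tendsto _).comp h0
      simpa [Function.comp_def] using this
    simpa using h.mul_const (rateKernel T S D s)

theorem integral_exp_mul_rateKernel_le {T S D r : ℝ} (hT : 0 ≤ T) (hTS : T ≤ S) (hD : 0 ≤ D)
    (hi : IntegrableOn (rateKernel T S D) (Set.Ioi 0)) (hr : 0 < r) :
    ∫ s in Set.Ioi 0, Real.exp (-(s / r)) * rateKernel T S D s ≤
      ∫ s in Set.Ioi 0, rateKernel T S D s := by
  refine integral_mono_of_nonneg ((ae_restrict_iff' measurableSet_Ioi).2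
    (Eventually.of_forall fun s hs => ?_)) hi ((ae_restrict_iff' measurableSet_Ioi).2
    (Eventually.of_forall fun s hs => ?_))
  · exact mul_nonneg (Real.exp_pos _).le (rateKernel_nonneg hT hTS hD hs)
  · refine mul_le_of_le_one_left (rateKernel_nonneg hT hTS hD hs) (Real.exp_le_one_iff.2 ?_)
    exact neg_nonpos.2 (div_nonneg (le_of_lt hs) hr.le)

/-! ### The trade-off between the two users -/

/-- For a covariance matrix `Σ` with eigenvalue quotient `χ`, and unit beams `a`, `b` whose squared
components along the first eigenvector add up to `m` and whose squared determinant is `D`, the least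
`c` with `a^H Σ a + b^H Σ b ≤ c tr Σ` and `D ≤ c²`. -/
noncomputable def powerScale (m D χ : ℝ) : ℝ := max ((2 + (χ - 1) * m) / (χ + 1)) √D

theorem powerScale_pos {m D χ : ℝ} (hχ : 0 < χ) (hm0 : 0 ≤ m) (hm2 : m ≤ 2) :
    0 < powerScale m D χ := by
  refine lt_max_of_lt_left (div_pos ?_ (by linarith))
  nlinarith [mul_nonneg hχ.le hm0]

theorem powerScale_monotone {m D χ χ' : ℝ} (hχ : 0 < χ) (h : χ ≤ χ') (hm : 1 ≤ m) :
    powerScale m D χ ≤ powerScale m D χ' := by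
  refine max_le_max_right _ ?_
  rw [div_le_div_iff₀ (by linarith) (by linarith)]
  nlinarith [mul_nonneg (sub_nonneg.2 h) (sub_nonneg.2 hm)]

theorem powerScale_antitone {m D χ χ' : ℝ} (hχ : 0 < χ) (h : χ ≤ χ') (hm : m ≤ 1) :
    powerScale m D χ' ≤ powerScale m D χ := by
  refine max_le_max_right _ ?_
  rw [div_le_div_iff₀ (by linarith) (by linarith)]
  nlinarith [mul_nonneg (sub_nonneg.2 h) (sub_nonneg.2 hm)]

/-- The case of equal condition numbers: since the ratio of `1 + (χ - 1) p` and `1 + (χ - 1) q` lies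
between `χ⁻¹` and `χ`, the quotient of their squared sum by their product is largest for `χ` and
`1`. -/
theorem powerScale_sq_mul_le {p q D χ : ℝ} (hχ : 0 < χ) (hp0 : 0 ≤ p) (hp1 : p ≤ 1) (hq0 : 0 ≤ q)
    (hq1 : q ≤ 1) (hD : 0 ≤ D) (hDχ : χ * D ≤ (1 + (χ - 1) * p) * (1 + (χ - 1) * q)) :
    powerScale (p + q) D χ ^ 2 * χ ≤ (1 + (χ - 1) * p) * (1 + (χ - 1) * q) := by
  rcases max_choice ((2 + (χ - 1) * (p + q)) / (χ + 1)) √D with h | h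
  · rw [powerScale, h, div_pow, div_mul_eq_mul_div, div_le_iff₀ (by positivity)]
    -- `(χ + 1)² s t - χ (s + t)² = (χ s - t) (χ t - s)` for `s = 1 + (χ - 1) p`, `t = 1 + (χ - 1) q`
    have h1 : 0 ≤ (χ - 1) ^ 2 * (1 - q + χ * p) * (1 - p + χ * q) := by
      have := mul_nonneg hχ.le hp0
      have := mul_nonneg hχ.le hq0
      exact mul_nonneg (mul_nonneg (sq_nonneg _) (by linarith)) (by linarith)
    linear_combination h1
  · rw [powerScale, h, Real.sq_sqrt hD]
    linarith

/-- The product of the two scaling factors is dominated by the interference powers. For `p + q ≥ 1`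
both sides are compared at the larger, otherwise at the smaller of the two condition numbers. -/
theorem powerScale_mul_powerScale_le {p q D χ χ' : ℝ} (hχ' : 0 < χ') (h : χ' ≤ χ) (hp0 : 0 ≤ p)
    (hp1 : p ≤ 1) (hq0 : 0 ≤ q) (hq1 : q ≤ 1) (hD : 0 ≤ D)
    (hDχ : χ * D ≤ (1 + (χ - 1) * p) * (1 + (χ - 1) * q))
    (hDχ' : χ' * D ≤ (1 + (χ' - 1) * p) * (1 + (χ' - 1) * q)) :
    powerScale (p + q) D χ * powerScale (p + q) D χ' * χ' ≤
      (1 + (χ - 1) * q) * (1 + (χ' - 1) * p) := by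
  have hχ : 0 < χ := hχ'.trans_le h
  have hc := powerScale_pos (m := p + q) (D := D) hχ (by linarith) (by linarith)
  have hc' := powerScale_pos (m := p + q) (D := D) hχ' (by linarith) (by linarith)
  have e := powerScale_sq_mul_le hχ hp0 hp1 hq0 hq1 hD hDχ
  have e' := powerScale_sq_mul_le hχ' hp0 hp1 hq0 hq1 hD hDχ'
  have hs : 0 < 1 + (χ - 1) * p := by
    rcases hp1.eq_or_lt with rfl | hp
    · linarith
    · nlinarith [mul_nonneg hχ.le hp0]
  have hs' : 0 < 1 + (χ' - 1) * p := by
    rcases hp1.eq_or_lt with rfl | hp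
    · linarith
    · nlinarith [mul_nonneg hχ'.le hp0]
  rcases le_total 1 (p + q) with hm | hm
  · have hle := powerScale_monotone (D := D) hχ' h hm
    have h1 : χ' * (1 + (χ - 1) * p) ≤ χ * (1 + (χ' - 1) * p) := by
      nlinarith [mul_nonneg (sub_nonneg.2 h) (sub_nonneg.2 hp1)]
    refine le_of_mul_le_mul_right ?_ hs
    calc powerScale (p + q) D χ * powerScale (p + q) D χ' * χ' * (1 + (χ - 1) * p)
        = powerScale (p + q) D χ * powerScale (p + q) D χ' * (χ' * (1 + (χ - 1) * p)) := by ring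
      _ ≤ powerScale (p + q) D χ * powerScale (p + q) D χ * (χ * (1 + (χ' - 1) * p)) := by
        gcongr
      _ = powerScale (p + q) D χ ^ 2 * χ * (1 + (χ' - 1) * p) := by ring
      _ ≤ (1 + (χ - 1) * p) * (1 + (χ - 1) * q) * (1 + (χ' - 1) * p) := by gcongr
      _ = (1 + (χ - 1) * q) * (1 + (χ' - 1) * p) * (1 + (χ - 1) * p) := by ring
  · have hle := powerScale_antitone (D := D) hχ' h hm
    calc powerScale (p + q) D χ * powerScale (p + q) D χ' * χ'
        ≤ powerScale (p + q) D χ' * powerScale (p + q) D χ' * χ' := by gcongr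
      _ = powerScale (p + q) D χ' ^ 2 * χ' := by ring
      _ ≤ (1 + (χ' - 1) * p) * (1 + (χ' - 1) * q) := e'
      _ ≤ (1 + (χ' - 1) * p) * (1 + (χ - 1) * q) := by gcongr
      _ = (1 + (χ - 1) * q) * (1 + (χ' - 1) * p) := by ring

theorem mul_logRatio {χ : ℝ} : χ * logRatio χ = Real.log χ + logRatio χ := by
  rcases eq_or_ne χ 1 with rfl | h
  · simp
  · rw [logRatio, if_neg h]
    have : χ - 1 ≠ 0 := sub_ne_zero.2 h
    field_simp
    ring

/-! ### The covariance matrix -/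

/-- `w^H Σ w` for the matrix `Σ` with eigenvectors `u` and eigenvalues `ev`. -/
noncomputable def beamPower (u : Fin 2 → EuclideanSpace ℂ (Fin 2)) (ev : Fin 2 → ℝ)
    (w : EuclideanSpace ℂ (Fin 2)) : ℝ :=
  ev 0 * ‖inner ℂ (u 0) w‖ ^ 2 + ev 1 * ‖inner ℂ (u 1) w‖ ^ 2

/-- The squared modulus of the determinant of the matrix with columns `a` and `b`. -/
noncomputable def beamDet (a b : EuclideanSpace ℂ (Fin 2)) : ℝ := ‖a 0 * b 1 - a 1 * b 0‖ ^ 2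

section Covariance

variable {u : Fin 2 → EuclideanSpace ℂ (Fin 2)} {ev : Fin 2 → ℝ}

theorem conjTranspose_mul_self_of_orthonormal (hu : Orthonormal ℂ u) :
    (Matrix.of fun a k => u k a)ᴴ * (Matrix.of fun a k => u k a) =
      (1 : Matrix (Fin 2) (Fin 2) ℂ) := by
  ext i j
  have h := orthonormal_iff_ite.1 hu i j
  rw [EuclideanSpace.inner_eq_star_dotProduct, dotProduct] at h
  rw [Matrix.mul_apply, Matrix.one_apply, ← h]
  exact Finset.sum_congr rfl fun k _ => mul_comm _ _

theorem sq_norm_inner_add_sq_norm_inner (hu : Orthonormal ℂ u) (w : EuclideanSpace ℂ (Fin 2)) :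
    ‖inner ℂ (u 0) w‖ ^ 2 + ‖inner ℂ (u 1) w‖ ^ 2 = ‖w‖ ^ 2 := by
  have h := (OrthonormalBasis.mk hu (hu.linearIndependent.span_eq_top_of_card_eq_finrank'
    (by simp)).ge).sum_sq_norm_inner_right w
  simpa [Fin.sum_univ_two] using h

theorem posSemidef_spectralMatrix (hev : ∀ k, 0 < ev k) : (spectralMatrix u ev).PosSemidef :=
  (Matrix.posSemidef_diagonal_iff.2 fun k => by
    exact_mod_cast (hev k).le).mul_mul_conjTranspose_same _

theorem sqrt_spectralMatrix_mul_self (hev : ∀ k, 0 < ev k) :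
    CFC.sqrt (spectralMatrix u ev) * CFC.sqrt (spectralMatrix u ev) = spectralMatrix u ev :=
  CFC.sqrt_mul_sqrt_self _ (posSemidef_spectralMatrix hev).nonneg

theorem conjTranspose_sqrt_spectralMatrix :
    (CFC.sqrt (spectralMatrix u ev))ᴴ = CFC.sqrt (spectralMatrix u ev) :=
  (IsSelfAdjoint.of_nonneg (CFC.sqrt_nonneg _)).star_eq

theorem sq_norm_sqrt_spectralMatrix_mulVec (hev : ∀ k, 0 < ev k) (w : EuclideanSpace ℂ (Fin 2)) :
    ‖(CFC.sqrt (spectralMatrix u ev) *ᵥ w.ofLp) 0‖ ^ 2 +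
      ‖(CFC.sqrt (spectralMatrix u ev) *ᵥ w.ofLp) 1‖ ^ 2 = beamPower u ev w := by
  set R := CFC.sqrt (spectralMatrix u ev) with hR
  have hU : ∀ k, ((Matrix.of fun a k => u k a)ᴴ *ᵥ w.ofLp) k = inner ℂ (u k) w := by
    intro k
    rw [EuclideanSpace.inner_eq_star_dotProduct, dotProduct_comm]
    rfl
  have h1 : star (R *ᵥ w.ofLp) ⬝ᵥ (R *ᵥ w.ofLp) =
      star ((Matrix.of fun a k => u k a)ᴴ *ᵥ w.ofLp) ⬝ᵥ
        (Matrix.diagonal (fun k => (ev k : ℂ)) *ᵥ ((Matrix.of fun a k => u k a)ᴴ *ᵥ w.ofLp)) := by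
    rw [Matrix.star_mulVec, Matrix.star_mulVec, ← Matrix.dotProduct_mulVec,
      ← Matrix.dotProduct_mulVec, Matrix.mulVec_mulVec, Matrix.mulVec_mulVec, Matrix.mulVec_mulVec,
      Matrix.conjTranspose_conjTranspose, conjTranspose_sqrt_spectralMatrix,
      sqrt_spectralMatrix_mul_self hev, spectralMatrix, Matrix.mul_assoc]
  have hz : ∀ z : ℂ, star z * z = ((‖z‖ ^ 2 : ℝ) : ℂ) := fun z => by
    rw [Complex.star_def, Complex.conj_mul', Complex.ofReal_pow]
  simp only [dotProduct, Fin.sum_univ_two, Pi.star_apply, Matrix.mulVec_diagonal, hU,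
    mul_left_comm _ ((ev _ : ℝ) : ℂ), hz] at h1
  exact_mod_cast h1

theorem beamDet_sqrt_spectralMatrix_mulVec (hu : Orthonormal ℂ u) (hev : ∀ k, 0 < ev k)
    (a b : EuclideanSpace ℂ (Fin 2)) :
    ‖(CFC.sqrt (spectralMatrix u ev) *ᵥ a.ofLp) 0 * (CFC.sqrt (spectralMatrix u ev) *ᵥ b.ofLp) 1 -
      (CFC.sqrt (spectralMatrix u ev) *ᵥ a.ofLp) 1 *
        (CFC.sqrt (spectralMatrix u ev) *ᵥ b.ofLp) 0‖ ^ 2 = ev 0 * ev 1 * beamDet a b := by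
  set R := CFC.sqrt (spectralMatrix u ev) with hR
  have h1 : (R *ᵥ a.ofLp) 0 * (R *ᵥ b.ofLp) 1 - (R *ᵥ a.ofLp) 1 * (R *ᵥ b.ofLp) 0 =
      R.det * (a 0 * b 1 - a 1 * b 0) := by
    simp only [Matrix.mulVec, dotProduct, Fin.sum_univ_two, Matrix.det_fin_two]
    ring
  have hU := congrArg Matrix.det (conjTranspose_mul_self_of_orthonormal hu)
  rw [Matrix.det_mul, Matrix.det_one] at hU
  have h2 : R.det * R.det = ev 0 * ev 1 := by
    rw [← Matrix.det_mul, hR, sqrt_spectralMatrix_mul_self hev, spectralMatrix, Matrix.det_mul,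
      Matrix.det_mul, mul_right_comm, mul_comm (Matrix.det (Matrix.of _)), hU, one_mul,
      Matrix.det_diagonal, Fin.prod_univ_two]
  rw [h1, beamDet, norm_mul, mul_pow]
  congr 1
  rw [pow_two, ← norm_mul, h2, ← Complex.ofReal_mul,
    Complex.norm_of_nonneg (mul_pos (hev 0) (hev 1)).le]

theorem beamPower_pos (hu : Orthonormal ℂ u) (hev : ∀ k, 0 < ev k)
    {w : EuclideanSpace ℂ (Fin 2)} (hw : ‖w‖ = 1) : 0 < beamPower u ev w := by
  have h := sq_norm_inner_add_sq_norm_inner hu w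
  rw [hw, one_pow] at h
  have h0 := hev 0
  have h1 := hev 1
  rcases (sq_nonneg ‖inner ℂ (u 0) w‖).eq_or_lt with h2 | h2
  · rw [beamPower, ← h2, show ‖inner ℂ (u 1) w‖ ^ 2 = 1 by linarith]
    linarith
  · rw [beamPower]
    positivity

theorem beamDet_nonneg (a b : EuclideanSpace ℂ (Fin 2)) : 0 ≤ beamDet a b := sq_nonneg _

theorem beamDet_comm (a b : EuclideanSpace ℂ (Fin 2)) : beamDet a b = beamDet b a := by
  rw [beamDet, beamDet, ← norm_neg]
  ring_nf

/-- The Cauchy–Schwarz inequality for `Σ^{1/2} a` and `Σ^{1/2} b`. -/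
theorem mul_beamDet_le (hu : Orthonormal ℂ u) (hev : ∀ k, 0 < ev k)
    (a b : EuclideanSpace ℂ (Fin 2)) :
    ev 0 * ev 1 * beamDet a b ≤ beamPower u ev a * beamPower u ev b := by
  rw [← beamDet_sqrt_spectralMatrix_mulVec hu hev, ← norm_sq_mul_sub_norm_sq_eq,
    sq_norm_sqrt_spectralMatrix_mulVec hev, sq_norm_sqrt_spectralMatrix_mulVec hev]
  exact sub_le_self _ (sq_nonneg _)

theorem beamDet_eq_one_of_inner_eq_zero {a b : EuclideanSpace ℂ (Fin 2)} (ha : ‖a‖ = 1)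
    (hb : ‖b‖ = 1) (hab : inner ℂ a b = 0) : beamDet a b = 1 := by
  have ha' := EuclideanSpace.norm_sq_eq a
  have hb' := EuclideanSpace.norm_sq_eq b
  rw [EuclideanSpace.inner_eq_star_dotProduct, dotProduct_comm, dotProduct] at hab
  simp only [Fin.sum_univ_two, Pi.star_apply] at ha' hb' hab
  rw [beamDet, ← norm_sq_mul_sub_norm_sq_eq, ← ha', ← hb', hab, ha, hb]
  norm_num

end Covariance

/-! ### The ergodic rate of one user -/

/-- The kernel of a user with covariance eigenvectors `u` and eigenvalues `ev`, for the user's own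
beam `a` and the interfering beam `b`. -/
noncomputable def beamKernel (u : Fin 2 → EuclideanSpace ℂ (Fin 2)) (ev : Fin 2 → ℝ)
    (a b : EuclideanSpace ℂ (Fin 2)) : ℝ → ℝ :=
  rateKernel (beamPower u ev b) (beamPower u ev a + beamPower u ev b) (ev 0 * ev 1 * beamDet a b)

/-- The high-SNR limit of the ergodic rate of a user with beam `a` and interfering beam `b`. -/
noncomputable def limitRate (u : Fin 2 → EuclideanSpace ℂ (Fin 2)) (ev : Fin 2 → ℝ)
    (a b : EuclideanSpace ℂ (Fin 2)) : ℝ :=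
  ∫ s in Set.Ioi 0, beamKernel u ev a b s

theorem inner_channel {Ω : Type*} (g : Fin 2 → Ω → ℂ) (u : Fin 2 → EuclideanSpace ℂ (Fin 2))
    (ev : Fin 2 → ℝ) (w : EuclideanSpace ℂ (Fin 2)) (ω : Ω) :
    inner ℂ (channel (spectralMatrix u ev) g ω) w =
      star (g 0 ω) * (CFC.sqrt (spectralMatrix u ev) *ᵥ w.ofLp) 0 +
        star (g 1 ω) * (CFC.sqrt (spectralMatrix u ev) *ᵥ w.ofLp) 1 := by
  rw [EuclideanSpace.inner_eq_star_dotProduct, channel, dotProduct_comm, Matrix.star_mulVec,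
    conjTranspose_sqrt_spectralMatrix, ← Matrix.dotProduct_mulVec, dotProduct, Fin.sum_univ_two]
  rfl

theorem aemeasurable_sq_norm_inner_channel {Ω : Type*} [MeasurableSpace Ω] {P : Measure Ω}
    {g : Fin 2 → Ω → ℂ} (hg : ∀ k, AEMeasurable (g k) P) (u : Fin 2 → EuclideanSpace ℂ (Fin 2))
    (ev : Fin 2 → ℝ) (w : EuclideanSpace ℂ (Fin 2)) :
    AEMeasurable (fun ω => ‖inner ℂ (channel (spectralMatrix u ev) g ω) w‖ ^ 2) P := by
  simp_rw [inner_channel, Complex.star_def]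
  have hc : Measurable (starRingEnd ℂ) := Complex.continuous_conj.measurable
  exact ((((hc.comp_aemeasurable (hg 0)).mul_const _).add
    ((hc.comp_aemeasurable (hg 1)).mul_const _)).norm).pow_const 2

theorem integral_exp_neg_of_iIndepFun {Ω : Type*} [MeasurableSpace Ω] {P : Measure Ω}
    [IsProbabilityMeasure P] {g : Fin 2 → Ω → ℂ} (hlaw : ∀ k, HasLaw (g k) stdComplexGaussian P)
    (hindep : iIndepFun g P) (a b : Fin 2 → ℂ) {t : ℝ} (ht : 0 ≤ t) :
    ∫ ω, Real.exp (-(t * (‖star (g 0 ω) * a 0 + star (g 1 ω) * a 1‖ ^ 2 +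
        ‖star (g 0 ω) * b 0 + star (g 1 ω) * b 1‖ ^ 2))) ∂P =
      (1 + ((‖a 0‖ ^ 2 + ‖a 1‖ ^ 2) + (‖b 0‖ ^ 2 + ‖b 1‖ ^ 2)) * t +
        ‖a 0 * b 1 - a 1 * b 0‖ ^ 2 * t ^ 2)⁻¹ := by
  have hprod := (indepFun_iff_hasLaw_prodMk_prod (hlaw 0) (hlaw 1)).1
    (hindep.indepFun (by decide : (0 : Fin 2) ≠ 1))
  have h := integral_exp_neg_stdComplexGaussian_prod (fun k => (√t : ℂ) * a k)
    (fun k => (√t : ℂ) * b k)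
  have hn : ‖(√t : ℂ)‖ ^ 2 = t := by
    rw [Complex.norm_of_nonneg (Real.sqrt_nonneg t), Real.sq_sqrt ht]
  have hdet : (√t : ℂ) * a 0 * ((√t : ℂ) * b 1) - (√t : ℂ) * a 1 * ((√t : ℂ) * b 0) =
      (√t : ℂ) ^ 2 * (a 0 * b 1 - a 1 * b 0) := by ring
  rw [← hprod.integral_comp (by fun_prop), hdet] at h
  simp only [Function.comp_def, mul_left_comm _ (√t : ℂ), ← mul_add, norm_mul, norm_pow, mul_pow,
    hn] at h
  rw [h]
  congr 1
  ring

theorem integrableOn_beamKernel {u : Fin 2 → EuclideanSpace ℂ (Fin 2)} {ev : Fin 2 → ℝ}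
    (hu : Orthonormal ℂ u) (hev : ∀ k, 0 < ev k) {a b : EuclideanSpace ℂ (Fin 2)} (ha : ‖a‖ = 1)
    (hb : ‖b‖ = 1) : IntegrableOn (beamKernel u ev a b) (Set.Ioi 0) := by
  have hA := beamPower_pos hu hev ha
  have hB := beamPower_pos hu hev hb
  have hD := mul_beamDet_le hu hev a b
  have hD0 := mul_nonneg (mul_pos (hev 0) (hev 1)).le (beamDet_nonneg a b)
  refine (integral_rateKernel_le hB hA hB one_pos (by linarith) hD0 ?_ ?_).1
  · rw [one_mul]
  · rwa [one_pow, one_mul]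

theorem integral_log_channel {Ω : Type*} [MeasurableSpace Ω] {P : Measure Ω}
    [IsProbabilityMeasure P] {g : Fin 2 → Ω → ℂ} (hlaw : ∀ k, HasLaw (g k) stdComplexGaussian P)
    (hindep : iIndepFun g P) {u : Fin 2 → EuclideanSpace ℂ (Fin 2)} {ev : Fin 2 → ℝ}
    (hu : Orthonormal ℂ u) (hev : ∀ k, 0 < ev k) {a b : EuclideanSpace ℂ (Fin 2)} (ha : ‖a‖ = 1)
    (hb : ‖b‖ = 1) {r : ℝ} (hr : 0 < r) :
    Integrable (fun ω => Real.log (1 + r * ‖inner ℂ (channel (spectralMatrix u ev) g ω) a‖ ^ 2 /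
        (1 + r * ‖inner ℂ (channel (spectralMatrix u ev) g ω) b‖ ^ 2))) P ∧
      ∫ ω, Real.log (1 + r * ‖inner ℂ (channel (spectralMatrix u ev) g ω) a‖ ^ 2 /
        (1 + r * ‖inner ℂ (channel (spectralMatrix u ev) g ω) b‖ ^ 2)) ∂P =
        ∫ s in Set.Ioi 0, Real.exp (-(s / r)) * beamKernel u ev a b s := by
  have hg := fun k => (hlaw k).aemeasurable
  refine integral_log_one_add_div (aemeasurable_sq_norm_inner_channel hg u ev a)
    (aemeasurable_sq_norm_inner_channel hg u ev b) (fun _ => sq_nonneg _) (fun _ => sq_nonneg _)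
    (beamPower_pos hu hev hb).le (le_add_of_nonneg_left (beamPower_pos hu hev ha).le)
    (mul_nonneg (mul_pos (hev 0) (hev 1)).le (beamDet_nonneg a b)) (fun t ht => ?_) (fun t ht => ?_)
    (integrableOn_beamKernel hu hev ha hb) hr
  · have h := integral_exp_neg_of_iIndepFun hlaw hindep 0
      (CFC.sqrt (spectralMatrix u ev) *ᵥ b.ofLp) ht.le
    simp only [Pi.zero_apply, mul_zero, zero_mul, add_zero, sub_zero, norm_zero, ne_eq,
      OfNat.ofNat_ne_zero, not_false_eq_true, zero_pow, zero_add,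
      sq_norm_sqrt_spectralMatrix_mulVec hev] at h
    simpa only [inner_channel] using h
  · have h := integral_exp_neg_of_iIndepFun hlaw hindep
      (CFC.sqrt (spectralMatrix u ev) *ᵥ a.ofLp) (CFC.sqrt (spectralMatrix u ev) *ᵥ b.ofLp) ht.le
    rw [sq_norm_sqrt_spectralMatrix_mulVec hev, sq_norm_sqrt_spectralMatrix_mulVec hev,
      beamDet_sqrt_spectralMatrix_mulVec hu hev] at h
    simpa only [inner_channel] using h

theorem limitRate_le {u : Fin 2 → EuclideanSpace ℂ (Fin 2)} {ev : Fin 2 → ℝ}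
    (hu : Orthonormal ℂ u) (hev : ∀ k, 0 < ev k) {a b : EuclideanSpace ℂ (Fin 2)} (ha : ‖a‖ = 1)
    (hb : ‖b‖ = 1) :
    limitRate u ev a b ≤
      Real.log (powerScale (‖inner ℂ (u 0) a‖ ^ 2 + ‖inner ℂ (u 0) b‖ ^ 2) (beamDet a b)
        (ev 0 / ev 1)) + Real.log (ev 1) + ev 0 / ev 1 * logRatio (ev 0 / ev 1) -
          Real.log (beamPower u ev b) := by
  have hA := beamPower_pos hu hev ha
  have hB := beamPower_pos hu hev hb
  have h0 := hev 0
  have h1 := hev 1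
  have hD0 := mul_nonneg (mul_pos h0 h1).le (beamDet_nonneg a b)
  have hpa := sq_norm_inner_add_sq_norm_inner hu a
  have hpb := sq_norm_inner_add_sq_norm_inner hu b
  rw [ha, one_pow] at hpa
  rw [hb, one_pow] at hpb
  set p := ‖inner ℂ (u 0) a‖ ^ 2 with hp
  set q := ‖inner ℂ (u 0) b‖ ^ 2 with hq
  have hp0 : 0 ≤ p := sq_nonneg _
  have hq0 : 0 ≤ q := sq_nonneg _
  have hc := powerScale_pos (m := p + q) (D := beamDet a b) (div_pos h0 h1) (by positivity)
    (by nlinarith [sq_nonneg ‖inner ℂ (u 1) a‖, sq_nonneg ‖inner ℂ (u 1) b‖])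
  refine (integral_rateKernel_le hB h0 h1 hc (by linarith) hD0 ?_ ?_).2
  · have hle := mul_le_mul_of_nonneg_right
      (le_max_left ((2 + (ev 0 / ev 1 - 1) * (p + q)) / (ev 0 / ev 1 + 1)) √(beamDet a b))
      (add_pos h0 h1).le
    refine le_trans (le_of_eq ?_) hle
    rw [beamPower, beamPower, ← hp, ← hq, eq_sub_of_add_eq' hpa, eq_sub_of_add_eq' hpb]
    field_simp
    ring
  · rw [mul_comm]
    refine mul_le_mul_of_nonneg_right ?_ (mul_pos h0 h1).le
    calc beamDet a b = √(beamDet a b) ^ 2 := (Real.sq_sqrt (beamDet_nonneg a b)).symm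
      _ ≤ _ := pow_le_pow_left₀ (Real.sqrt_nonneg _) (le_max_right _ _) 2

/-- The bound on the limiting sum-rate: adding the bounds on the two rates leaves the logarithm of
the quotient that `powerScale_mul_powerScale_le` estimates. -/
theorem limitRate_add_limitRate_le {u : Fin 2 → EuclideanSpace ℂ (Fin 2)} {ev ev' : Fin 2 → ℝ}
    (hu : Orthonormal ℂ u) (hev : ∀ k, 0 < ev k) (hev' : ∀ k, 0 < ev' k)
    (hle : ev' 0 / ev' 1 ≤ ev 0 / ev 1) {a b : EuclideanSpace ℂ (Fin 2)} (ha : ‖a‖ = 1)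
    (hb : ‖b‖ = 1) :
    limitRate u ev a b + limitRate u ev' b a ≤
      ev 0 / ev 1 * logRatio (ev 0 / ev 1) + logRatio (ev' 0 / ev' 1) := by
  have L := limitRate_le hu hev ha hb
  have L' := limitRate_le hu hev' hb ha
  have hpa := sq_norm_inner_add_sq_norm_inner hu a
  have hpb := sq_norm_inner_add_sq_norm_inner hu b
  rw [ha, one_pow] at hpa
  rw [hb, one_pow] at hpb
  have hD := mul_beamDet_le hu hev a b
  have hD' := mul_beamDet_le hu hev' a b
  have hA' := beamPower_pos hu hev' ha
  have hB := beamPower_pos hu hev hb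
  have hP : ∀ {ev : Fin 2 → ℝ}, (∀ k, 0 < ev k) → ∀ w : EuclideanSpace ℂ (Fin 2),
      ‖inner ℂ (u 0) w‖ ^ 2 + ‖inner ℂ (u 1) w‖ ^ 2 = 1 →
      beamPower u ev w = ev 1 * (1 + (ev 0 / ev 1 - 1) * ‖inner ℂ (u 0) w‖ ^ 2) := by
    intro ev hev w hw
    have := (hev 1).ne'
    rw [beamPower, eq_sub_of_add_eq' hw]
    field_simp
    ring
  rw [beamDet_comm, add_comm (‖inner ℂ (u 0) b‖ ^ 2), mul_logRatio] at L'
  rw [hP hev _ hpa, hP hev _ hpb] at hD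
  rw [hP hev' _ hpa, hP hev' _ hpb] at hD'
  rw [hP hev _ hpb] at L hB
  rw [hP hev' _ hpa] at L' hA'
  set p := ‖inner ℂ (u 0) a‖ ^ 2 with hp
  set q := ‖inner ℂ (u 0) b‖ ^ 2 with hq
  have hp0 : 0 ≤ p := sq_nonneg _
  have hq0 : 0 ≤ q := sq_nonneg _
  have hp1 : p ≤ 1 := by linarith [sq_nonneg ‖inner ℂ (u 1) a‖]
  have hq1 : q ≤ 1 := by linarith [sq_nonneg ‖inner ℂ (u 1) b‖]
  have hχ : 0 < ev 0 / ev 1 := div_pos (hev 0) (hev 1)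
  have hχ' : 0 < ev' 0 / ev' 1 := div_pos (hev' 0) (hev' 1)
  have hnorm : ∀ {ev : Fin 2 → ℝ}, (∀ k, 0 < ev k) → ev 0 * ev 1 * beamDet a b ≤
      ev 1 * (1 + (ev 0 / ev 1 - 1) * p) * (ev 1 * (1 + (ev 0 / ev 1 - 1) * q)) →
      ev 0 / ev 1 * beamDet a b ≤
        (1 + (ev 0 / ev 1 - 1) * p) * (1 + (ev 0 / ev 1 - 1) * q) := by
    intro ev hev h
    have h1 := hev 1
    refine le_of_mul_le_mul_left ?_ (pow_pos h1 2)
    calc ev 1 ^ 2 * (ev 0 / ev 1 * beamDet a b) = ev 0 * ev 1 * beamDet a b := by field_simp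
      _ ≤ _ := h
      _ = _ := by ring
  have key := powerScale_mul_powerScale_le hχ' hle hp0 hp1 hq0 hq1 (beamDet_nonneg a b)
    (hnorm hev hD) (hnorm hev' hD')
  have hc := powerScale_pos (m := p + q) (D := beamDet a b) hχ (by linarith) (by linarith)
  have hc' := powerScale_pos (m := p + q) (D := beamDet a b) hχ' (by linarith) (by linarith)
  have ht := pos_of_mul_pos_right hB (hev 1).le
  have hs := pos_of_mul_pos_right hA' (hev' 1).le
  have hlog := Real.log_le_log (by positivity) key
  rw [Real.log_mul (by positivity) hχ'.ne', Real.log_mul hc.ne' hc'.ne',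
    Real.log_mul ht.ne' hs.ne'] at hlog
  rw [Real.log_mul (hev 1).ne' ht.ne'] at L
  rw [Real.log_mul (hev' 1).ne' hs.ne'] at L'
  linarith

/-- The limiting rate for beams whose total power and determinant are those of an orthonormal pair. -/
theorem limitRate_eq {u : Fin 2 → EuclideanSpace ℂ (Fin 2)} {ev : Fin 2 → ℝ}
    (hev : ∀ k, 0 < ev k) {a b : EuclideanSpace ℂ (Fin 2)} (hD : beamDet a b = 1)
    (hS : beamPower u ev a + beamPower u ev b = ev 0 + ev 1) (ha : 0 < beamPower u ev a)
    (hb : 0 < beamPower u ev b) :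
    limitRate u ev a b = Real.log (ev 1) + ev 0 / ev 1 * logRatio (ev 0 / ev 1) -
      Real.log (beamPower u ev b) := by
  rw [← (integral_rateKernel hb (hev 0) (hev 1) (by linarith)).2, limitRate, beamKernel, hD, hS,
    mul_one]

theorem beamPower_exp_smul {u : Fin 2 → EuclideanSpace ℂ (Fin 2)} (hu : Orthonormal ℂ u)
    (ev : Fin 2 → ℝ) (x : ℝ) (k : Fin 2) :
    beamPower u ev (Complex.exp (x * Complex.I) • u k) = ev k := by
  have h := orthonormal_iff_ite.1 hu
  fin_cases k <;> simp [beamPower, h, hu.1, Complex.norm_exp_ofReal_mul_I]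

theorem norm_exp_smul {u : Fin 2 → EuclideanSpace ℂ (Fin 2)} (hu : Orthonormal ℂ u) (x : ℝ)
    (k : Fin 2) : ‖Complex.exp (x * Complex.I) • u k‖ = 1 := by
  rw [norm_smul, Complex.norm_exp_ofReal_mul_I, hu.1, mul_one]

theorem limitRate_add_limitRate_eigenbeams {u : Fin 2 → EuclideanSpace ℂ (Fin 2)}
    {ev ev' : Fin 2 → ℝ} (hu : Orthonormal ℂ u) (hev : ∀ k, 0 < ev k) (hev' : ∀ k, 0 < ev' k)
    (x y : ℝ) :
    limitRate u ev (Complex.exp (x * Complex.I) • u 0) (Complex.exp (y * Complex.I) • u 1) +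
      limitRate u ev' (Complex.exp (y * Complex.I) • u 1) (Complex.exp (x * Complex.I) • u 0) =
      ev 0 / ev 1 * logRatio (ev 0 / ev 1) + logRatio (ev' 0 / ev' 1) := by
  have hD : beamDet (Complex.exp (x * Complex.I) • u 0) (Complex.exp (y * Complex.I) • u 1) = 1 := by
    refine beamDet_eq_one_of_inner_eq_zero (norm_exp_smul hu x 0) (norm_exp_smul hu y 1) ?_
    rw [inner_smul_left, inner_smul_right, hu.2 (by decide), mul_zero, mul_zero]
  have hD' := hD
  rw [beamDet_comm] at hD'
  rw [limitRate_eq hev hD, limitRate_eq hev' hD', beamPower_exp_smul hu, beamPower_exp_smul hu,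
    mul_logRatio (χ := ev' 0 / ev' 1), Real.log_div (hev' 0).ne' (hev' 1).ne']
  · ring
  all_goals simp only [beamPower_exp_smul hu]
  · ring
  · exact hev' 1
  · exact hev' 0
  · exact hev 0
  · exact hev 1

/-! ### The sum-rate -/

theorem theorem3 {Ω : Type*} [MeasurableSpace Ω] (P : Measure Ω) [IsProbabilityMeasure P]
    -- `g i` is the vector of i.i.d. `CN(0,1)` entries behind the channel of user `i`
    (g : Fin 2 → Fin 2 → Ω → ℂ)
    (hlaw : ∀ i k, HasLaw (g i k) stdComplexGaussian P)
    (hindep : ∀ i, iIndepFun (g i) P)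
    -- common orthonormal eigenvectors, with eigenvalues `lam` and `mu`
    (u : Fin 2 → EuclideanSpace ℂ (Fin 2)) (hu : Orthonormal ℂ u)
    (lam mu : Fin 2 → ℝ) (hlam : ∀ k, 0 < lam k) (hmu : ∀ k, 0 < mu k)
    (S : Fin 2 → Matrix (Fin 2) (Fin 2) ℂ)
    (hS₁ : S 0 = spectralMatrix u lam) (hS₂ : S 1 = spectralMatrix u mu)
    (h : Fin 2 → Ω → EuclideanSpace ℂ (Fin 2)) (hh : ∀ i, h i = channel (S i) (g i))
    (χ₁ χ₂ : ℝ) (hχ₁ : χ₁ = lam 0 / lam 1) (hχ₂ : χ₂ = mu 0 / mu 1) :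
    -- all expectations exist
    (∀ ρ : ℝ, 0 < ρ → ∀ w : Fin 2 → EuclideanSpace ℂ (Fin 2), (∀ i, ‖w i‖ = 1) →
      ∀ i, Integrable (fun ω => instRate ρ (fun k => h k ω) w i) P) ∧
    -- every unit-norm choice has a high-SNR limit, which is at most the claimed value
    (∀ w : Fin 2 → EuclideanSpace ℂ (Fin 2), (∀ i, ‖w i‖ = 1) →
      ∃ L : ℝ, Tendsto (ergodicSumRate P h w) atTop (𝓝 L) ∧ L ≤ limitValue χ₁ χ₂) ∧
    -- the claimed choice consists of unit vectors and has the claimed value as its limit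
    (∀ ν : Fin 2 → ℝ, (∀ i, ‖optimalBeams u χ₁ χ₂ ν i‖ = 1) ∧
      Tendsto (ergodicSumRate P h (optimalBeams u χ₁ χ₂ ν)) atTop (𝓝 (limitValue χ₁ χ₂))) ∧
    -- the optimal sum-rate at `ρ` is finite and converges to the claimed value
    (∃ Ropt : ℝ → ℝ, (∀ ρ : ℝ, 0 < ρ → IsLUB (achievableSumRates P h ρ) (Ropt ρ)) ∧
      Tendsto Ropt atTop (𝓝 (limitValue χ₁ χ₂))) := by
  set ev : Fin 2 → Fin 2 → ℝ := ![lam, mu] with hev_def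
  have hev : ∀ i k, 0 < ev i k := by
    intro i k
    fin_cases i
    · exact hlam k
    · exact hmu k
  have hh' : ∀ i, h i = channel (spectralMatrix u (ev i)) (g i) := by
    intro i
    rw [hh]
    fin_cases i
    · exact congrArg (fun S => channel S (g 0)) hS₁
    · exact congrArg (fun S => channel S (g 1)) hS₂
  -- `1 - i` is the index of the interfering user
  have hinst : ∀ ρ w i, (fun ω => instRate ρ (fun k => h k ω) w i) = fun ω =>
      Real.log (1 + ρ / 2 * ‖inner ℂ (channel (spectralMatrix u (ev i)) (g i) ω) (w i)‖ ^ 2 /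
        (1 + ρ / 2 * ‖inner ℂ (channel (spectralMatrix u (ev i)) (g i) ω) (w (1 - i))‖ ^ 2)) := by
    intro ρ w i
    funext ω
    have he : Finset.univ.erase i = {1 - i} := by
      revert i
      decide
    rw [instRate, he, Finset.sum_singleton, hh', Nat.cast_ofNat]
  have hrate : ∀ ρ : ℝ, 0 < ρ → ∀ w : Fin 2 → EuclideanSpace ℂ (Fin 2), (∀ i, ‖w i‖ = 1) → ∀ i,
      Integrable (fun ω => instRate ρ (fun k => h k ω) w i) P ∧
        ∫ ω, instRate ρ (fun k => h k ω) w i ∂P =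
          ∫ s in Set.Ioi 0, Real.exp (-(s / (ρ / 2))) * beamKernel u (ev i) (w i) (w (1 - i)) s := by
    intro ρ hρ w hw i
    rw [hinst]
    exact integral_log_channel (hlaw i) (hindep i) hu (hev i) (hw i) (hw (1 - i)) (half_pos hρ)
  have hsum : ∀ ρ w, ergodicSumRate P h w ρ = ∫ ω, instRate ρ (fun k => h k ω) w 0 ∂P +
      ∫ ω, instRate ρ (fun k => h k ω) w 1 ∂P := fun ρ w => Fin.sum_univ_two _
  have hpos : ∀ (w : Fin 2 → EuclideanSpace ℂ (Fin 2)), (∀ i, ‖w i‖ = 1) → ∀ i,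
      0 ≤ beamPower u (ev i) (w (1 - i)) ∧
        beamPower u (ev i) (w (1 - i)) ≤
          beamPower u (ev i) (w i) + beamPower u (ev i) (w (1 - i)) ∧
        0 ≤ ev i 0 * ev i 1 * beamDet (w i) (w (1 - i)) := fun w hw i =>
    ⟨(beamPower_pos hu (hev i) (hw (1 - i))).le,
      le_add_of_nonneg_left (beamPower_pos hu (hev i) (hw i)).le,
      mul_nonneg (mul_pos (hev i 0) (hev i 1)).le (beamDet_nonneg _ _)⟩
  have hle : ∀ ρ : ℝ, 0 < ρ → ∀ w : Fin 2 → EuclideanSpace ℂ (Fin 2), (∀ i, ‖w i‖ = 1) →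
      ergodicSumRate P h w ρ ≤ limitRate u lam (w 0) (w 1) + limitRate u mu (w 1) (w 0) := by
    intro ρ hρ w hw
    have hi : ∀ i, ∫ ω, instRate ρ (fun k => h k ω) w i ∂P ≤
        limitRate u (ev i) (w i) (w (1 - i)) := by
      intro i
      obtain ⟨h1, h2, h3⟩ := hpos w hw i
      rw [(hrate ρ hρ w hw i).2]
      exact integral_exp_mul_rateKernel_le h1 h2 h3
        (integrableOn_beamKernel hu (hev i) (hw i) (hw (1 - i))) (half_pos hρ)
    rw [hsum]
    exact add_le_add (hi 0) (hi 1)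
  have htend : ∀ w : Fin 2 → EuclideanSpace ℂ (Fin 2), (∀ i, ‖w i‖ = 1) →
      Tendsto (ergodicSumRate P h w) atTop
        (𝓝 (limitRate u lam (w 0) (w 1) + limitRate u mu (w 1) (w 0))) := by
    intro w hw
    have hi : ∀ i, Tendsto (fun ρ => ∫ ω, instRate ρ (fun k => h k ω) w i ∂P) atTop
        (𝓝 (limitRate u (ev i) (w i) (w (1 - i)))) := by
      intro i
      obtain ⟨h1, h2, h3⟩ := hpos w hw i
      refine ((tendsto_integral_exp_mul_rateKernel h1 h2 h3 (integrableOn_beamKernel hu (hev i)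
        (hw i) (hw (1 - i)))).comp (tendsto_id.atTop_div_const two_pos)).congr' ?_
      filter_upwards [eventually_gt_atTop 0] with ρ hρ
      exact (hrate ρ hρ w hw i).2.symm
    exact ((hi 0).add (hi 1)).congr fun ρ => (hsum ρ w).symm
  have hbound : ∀ w : Fin 2 → EuclideanSpace ℂ (Fin 2), (∀ i, ‖w i‖ = 1) →
      limitRate u lam (w 0) (w 1) + limitRate u mu (w 1) (w 0) ≤ limitValue χ₁ χ₂ := by
    intro w hw
    rw [limitValue, hχ₁, hχ₂]
    split_ifs with hχ
    · exact limitRate_add_limitRate_le hu hlam hmu hχ (hw 0) (hw 1)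
    · rw [add_comm]
      exact limitRate_add_limitRate_le hu hmu hlam (not_le.1 hχ).le (hw 1) (hw 0)
  have hopt : ∀ ν : Fin 2 → ℝ, (∀ i, ‖optimalBeams u χ₁ χ₂ ν i‖ = 1) ∧
      Tendsto (ergodicSumRate P h (optimalBeams u χ₁ χ₂ ν)) atTop (𝓝 (limitValue χ₁ χ₂)) := by
    intro ν
    have hnorm : ∀ i, ‖optimalBeams u χ₁ χ₂ ν i‖ = 1 := by
      intro i
      rw [optimalBeams]
      split_ifs <;> fin_cases i <;> exact norm_exp_smul hu _ _
    refine ⟨hnorm, ?_⟩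
    convert htend _ hnorm using 2
    rw [limitValue, optimalBeams, hχ₁, hχ₂]
    split_ifs with hχ
    · exact (limitRate_add_limitRate_eigenbeams hu hlam hmu (ν 0) (ν 1)).symm
    · rw [add_comm (limitRate _ _ _ _)]
      exact (limitRate_add_limitRate_eigenbeams hu hmu hlam (ν 0) (ν 1)).symm
  refine ⟨fun ρ hρ w hw i => (hrate ρ hρ w hw i).1, fun w hw => ⟨_, htend w hw, hbound w hw⟩, hopt,
    fun ρ => sSup (achievableSumRates P h ρ), ?_⟩
  obtain ⟨hnorm, hlim⟩ := hopt 0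
  have hV : ∀ ρ : ℝ, 0 < ρ → limitValue χ₁ χ₂ ∈ upperBounds (achievableSumRates P h ρ) := by
    rintro ρ hρ _ ⟨w, hw, rfl⟩
    exact (hle ρ hρ w hw).trans (hbound w hw)
  have hmem : ∀ ρ : ℝ, ergodicSumRate P h (optimalBeams u χ₁ χ₂ 0) ρ ∈ achievableSumRates P h ρ :=
    fun ρ => ⟨_, hnorm, rfl⟩
  refine ⟨fun ρ hρ => isLUB_csSup ⟨_, hmem ρ⟩ ⟨_, hV ρ hρ⟩, ?_⟩
  -- the optimal rate lies between the rate of the eigenbeams and the limit of that rate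
  refine tendsto_of_tendsto_of_tendsto_of_le_of_le' hlim tendsto_const_nhds ?_ ?_
  · filter_upwards [eventually_gt_atTop 0] with ρ hρ
    exact le_csSup ⟨_, hV ρ hρ⟩ (hmem ρ)
  · filter_upwards [eventually_gt_atTop 0] with ρ hρ
    exact csSup_le ⟨_, hmem ρ⟩ (hV ρ hρ)
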